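/- Let $(s_n)_{n\ge 0}$ be a real sequence such that the Hamburger moment problem for $(s_n)$ is indeterminate: there are two different probability measures $\mu$ on $\mathbb R$ with moments of any order and $s_n=\int x^n\,d\mu(x)$ for all $n\ge 0$. Let $P_n(x)=\sum_{k=0}^n b_{k,n}x^k$ be the orthonormal polynomials obtained from the monomials $1,x,x^2,\dots$ by the Gram--Schmidt procedure with respect to $\langle p,q\rangle=\int pq\,d\mu$ (which depends only on $(s_n)$), with $b_{k,n}=0$ for $k>n$, and let $\mathcal H=\{s_{m+n}\}_{m,n\ge 0}$. Let $a_{j,k}(N)$ be the coefficients of $K_N(z,w)=\sum_{n=0}^N P_n(z)P_n(w)=\sum_{j,k=0}^N a_{j,k}(N)z^jw^k$, and put $a_{j,k}=\lim_{N\to\infty}a_{j,k}(N)$, $\mathcal A=\{a_{j,k}\}_{j,k\ge 0}$ and $c_k=\sqrt{a_{k,k}}$. Consider the properties - (c): the series $\sum_{k=0}^\infty a_{i,k}s_{k+j}$ is convergent for all $i,j\ge 0$; - (ac): the series $\sum_{k=0}^\infty a_{i,k}s_{k+j}$ is absolutely convergent for all $i,j\ge 0$; - (aci): (ac) holds and $\mathcal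 A\mathcal H=\mathcal H\mathcal A=\mathcal I$, i.e. $\sum_{k=0}^\infty a_{i,k}s_{k+j}=\delta_{i,j}$ and $\sum_{k=0}^\infty s_{i+k}a_{k,j}=\delta_{i,j}$ for all $i,j\ge 0$; - (cs): $\sum_{n=0}^\infty c_{2n}s_{2n}<\infty$; - (cs*): $\sum_{l=0}^\infty c_l|s_{l+m}|<\infty$ for all $m\ge 0$. Then the limits $a_{j,k}$ exist, $\mathcal A=\mathcal B\mathcal B^t$ with $\mathcal B=\{b_{k,n}\}$, i.e. $a_{k,l}=\sum_{n=0}^\infty b_{k,n}b_{l,n}$ with absolute convergence, and 1. (cs*) $\Rightarrow$ (aci) $\Rightarrow$ (ac) $\Rightarrow$ (c); 2. (cs*) $\Rightarrow$ (cs); 3. if $\sum_{n,l=0}^\infty|b_{k,n}b_{l,n}s_{l+m}|<\infty$ for all $k,m\ge 0$, then (aci) holds; and this condition holds whenever (cs*) holds. -/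

import Mathlib

open Polynomial Filter Topology MeasureTheory

namespace HamburgerMoment

noncomputable section

/-- `μ` solves the Hamburger moment problem for `s`: it is a probability measure on the real line
with moments of any order, and `s n = ∫ x ^ n dμ(x)` for all `n ≥ 0`. -/
structure IsSolution (s : ℕ → ℝ) (μ : Measure ℝ) : Prop where
  isProbabilityMeasure : IsProbabilityMeasure μ
  integrable_pow : ∀ n : ℕ, Integrable (fun x : ℝ => x ^ n) μ
  integral_pow : ∀ n : ℕ, ∫ x : ℝ, x ^ n ∂μ = s n

/-- The moment problem for `s` is indeterminate: `s` is the moment sequence of at least two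
different measures. (These then have infinite support: a measure with finite support is determined
by its moments.) -/
def IsIndeterminate (s : ℕ → ℝ) : Prop :=
  ∃ μ ν : Measure ℝ, IsSolution s μ ∧ IsSolution s ν ∧ μ ≠ ν

/-- The infinite Hankel matrix `H = {s_{m+n}}`. -/
def hankel (s : ℕ → ℝ) : Matrix ℕ ℕ ℝ := Matrix.of fun m n => s (m + n)

/-- The linear functional on polynomials with `x ^ n ↦ s n`, that is, integration with respect to
any solution of the moment problem (see `momentFunctional_eq_integral`). -/
def momentFunctional (s : ℕ → ℝ) (p : ℝ[X]) : ℝ := p.sum fun n a => a * s n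

theorem momentFunctional_eq_integral {s : ℕ → ℝ} {μ : Measure ℝ} (h : IsSolution s μ)
    (p : ℝ[X]) : momentFunctional s p = ∫ x : ℝ, p.eval x ∂μ := by
  have e : (fun x : ℝ => p.eval x) = fun x => ∑ n ∈ p.support, p.coeff n * x ^ n := by
    funext x
    rw [Polynomial.eval_eq_sum, Polynomial.sum_def]
  rw [e, integral_finsetSum _ fun n _ => (h.integrable_pow n).const_mul _, momentFunctional,
    Polynomial.sum_def]
  exact Finset.sum_congr rfl fun n _ => by rw [integral_const_mul, h.integral_pow]

/-- The inner product `⟨p, q⟩ = ∫ p q dμ` of real polynomials in `L²(μ)`, for `μ` any solution. -/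
def polyInner (s : ℕ → ℝ) (p q : ℝ[X]) : ℝ := momentFunctional s (p * q)

/-- The Gram-Schmidt procedure, before normalization, applied to the monomials `x ^ n`. -/
def monicOrthPoly (s : ℕ → ℝ) (n : ℕ) : ℝ[X] :=
  X ^ n - ∑ i : Fin n,
    C (polyInner s (X ^ n) (monicOrthPoly s i) /
      polyInner s (monicOrthPoly s i) (monicOrthPoly s i)) * monicOrthPoly s i
termination_by n
decreasing_by all_goals exact i.isLt

/-- The orthonormal polynomials `P_n`, obtained from the monomials by Gram-Schmidt. -/
def orthPoly (s : ℕ → ℝ) (n : ℕ) : ℝ[X] :=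
  C (Real.sqrt (polyInner s (monicOrthPoly s n) (monicOrthPoly s n)))⁻¹ * monicOrthPoly s n

/-- The upper triangular matrix `B` of coefficients of the orthonormal polynomials:
`P_n(x) = ∑_{k ≤ n} b_{k,n} x ^ k`. -/
def coeffMatrix (s : ℕ → ℝ) : Matrix ℕ ℕ ℝ := Matrix.of fun k n => (orthPoly s n).coeff k

/-- The truncated kernel `K_N(z, w) = ∑_{n=0}^N P_n(z) P_n(w)` as a polynomial in two variables:
`z` is the inner variable and `w` the outer variable of `ℝ[X][X]`. -/
def truncKernel (s : ℕ → ℝ) (N : ℕ) : ℝ[X][X] :=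
  ∑ n ∈ Finset.range (N + 1), C (orthPoly s n) * (orthPoly s n).map C

/-- The coefficient `a_{j,k}(N)` of `z ^ j w ^ k` in `K_N(z, w)`. -/
def truncKernelCoeff (s : ℕ → ℝ) (N j k : ℕ) : ℝ := ((truncKernel s N).coeff k).coeff j

theorem truncKernelCoeff_eq (s : ℕ → ℝ) (N j k : ℕ) :
    truncKernelCoeff s N j k =
      ∑ n ∈ Finset.range (N + 1), coeffMatrix s j n * coeffMatrix s k n := by
  simp [truncKernelCoeff, truncKernel, coeffMatrix, Polynomial.finsetSum_coeff]

/-- The matrix `A = {a_{j,k}}`, `a_{j,k} = lim_{N → ∞} a_{j,k}(N)`, the coefficient matrix of the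
reproducing kernel `K(z, w) = ∑_{n=0}^∞ P_n(z) P_n(w)`. -/
def kernelMatrix (s : ℕ → ℝ) : Matrix ℕ ℕ ℝ :=
  Matrix.of fun j k => limUnder atTop fun N => truncKernelCoeff s N j k

/-- The numbers `c_k = √a_{k,k}`. -/
def kernelDiagSqrt (s : ℕ → ℝ) (k : ℕ) : ℝ := Real.sqrt (kernelMatrix s k k)

/-- The product of the infinite matrices `M` and `M'` is the matrix `R`: all the series
`∑_{k=0}^∞ M_{i,k} M'_{k,j}` are convergent, as limits of partial sums, with sum `R_{i,j}`. -/
def IsInfProd (M M' R : Matrix ℕ ℕ ℝ) : Prop :=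
  ∀ i j, Tendsto (fun N => ∑ k ∈ Finset.range N, M i k * M' k j) atTop (𝓝 (R i j))

/-- Property (c): the series `∑_k a_{i,k} s_{k+j}` are all convergent. -/
def PropC (s : ℕ → ℝ) : Prop :=
  ∃ R : Matrix ℕ ℕ ℝ, IsInfProd (kernelMatrix s) (hankel s) R

/-- Property (ac): the series `∑_k a_{i,k} s_{k+j}` are all absolutely convergent. -/
def PropAC (s : ℕ → ℝ) : Prop :=
  ∀ i j, Summable fun k => |kernelMatrix s i k * hankel s k j|

/-- Property (aci): property (ac) holds, and `A H = H A = I`. -/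
def PropACI (s : ℕ → ℝ) : Prop :=
  PropAC s ∧ IsInfProd (kernelMatrix s) (hankel s) 1 ∧ IsInfProd (hankel s) (kernelMatrix s) 1

/-- Property (cs): `∑_n c_{2n} s_{2n} < ∞`. -/
def PropCS (s : ℕ → ℝ) : Prop := Summable fun n => kernelDiagSqrt s (2 * n) * s (2 * n)

/-- Property (cs*): `∑_l c_l |s_{l+m}| < ∞` for all `m ≥ 0`. -/
def PropCSStar (s : ℕ → ℝ) : Prop :=
  ∀ m, Summable fun l => kernelDiagSqrt s l * |s (l + m)|

/-- The condition `∑_{n,l} |b_{k,n} b_{l,n} s_{l+m}| < ∞` for all `k, m ≥ 0`. -/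
def DoubleSeriesCondition (s : ℕ → ℝ) : Prop :=
  ∀ k m, Summable fun p : ℕ × ℕ => |coeffMatrix s k p.1 * coeffMatrix s p.2 p.1 * s (p.2 + m)|

end

end HamburgerMoment

/-!
The point is that the rows of `B` are square summable (`IsIndeterminate.summable_coeffMatrix_sq`);
everything else is Cauchy-Schwarz and summation by rows and columns.

Evaluation of polynomials at `i` is bounded in the norm of `L²(μ)`: otherwise there are polynomials
`q` with `q(i) = 1` and arbitrarily small norm, so that `1 / (x - i)` is approximated by the
polynomials `(1 - q(x)) / (x - i)` in `L²` of every solution at once. Hence, if integration of `g p`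
against two solutions `μ`, `ν` agrees for all polynomials `p`, the same holds for `g / (x - i)`, and
likewise for its conjugate. The star algebra generated by `1 / (x - i)` separates points, so `μ = ν`
(`IsSolution.eq_of_eval_unbounded`). This also shows that the inner product is positive definite, so
that the `P_n` are orthonormal, and it yields `∑ |P_n(i)|² < ∞`.

Write `P_n(x) = P_n(i) + (x - i) ∑_{k < n} a_{n,k} P_k(x)`. With `q_n = ∫ P_n(x) / (x - i) dμ(x)`,
a square summable sequence by Bessel, orthogonality gives `a_{n,k} = P_k(i) q_n - P_n(i) q_k`, a
Hilbert-Schmidt matrix. Comparing coefficients of `x ^ j`, the row `b_j` of `B` solves a Volterra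
equation `b_j + i T b_j = c`, where `c` is `(P_n(i))_n` for `j = 0` and `T b_{j-1}` for `j > 0`. A
discrete Grönwall inequality then gives `b_j ∈ ℓ²` by induction on `j`.

For the products, `∑_l b_{l,n} s_{l+m} = ⟨P_n, x ^ m⟩` is a finite sum, and
`∑_n b_{k,n} ⟨P_n, x ^ m⟩ = δ_{k,m}` is the expansion of `x ^ m` in the basis `P_n`. Absolute
convergence of the double series allows the exchange of summations that turns this into `A H = I`.
-/

namespace HamburgerMoment

/-! ### Integrals of complex polynomials over the real line -/

theorem IsSolution.integrable_eval {s : ℕ → ℝ} {μ : Measure ℝ} (h : IsSolution s μ) (p : ℂ[X]) :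
    Integrable (fun x : ℝ => p.eval (x : ℂ)) μ := by
  simp only [Polynomial.eval_eq_sum, Polynomial.sum_def]
  refine integrable_finsetSum _ fun n _ => Integrable.const_mul ?_ _
  simpa using (h.integrable_pow n).ofReal (𝕜 := ℂ)

theorem IsSolution.integral_eval {s : ℕ → ℝ} {μ : Measure ℝ} (h : IsSolution s μ) (p : ℂ[X]) :
    ∫ x : ℝ, p.eval (x : ℂ) ∂μ = p.sum fun n a => a * s n := by
  simp only [Polynomial.eval_eq_sum, Polynomial.sum_def]
  rw [integral_finsetSum]
  · refine Finset.sum_congr rfl fun n _ => ?_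
    rw [integral_const_mul, ← h.integral_pow, ← integral_complex_ofReal]
    simp
  · intro n _
    refine Integrable.const_mul ?_ _
    simpa using (h.integrable_pow n).ofReal (𝕜 := ℂ)

theorem eval_map_conj_ofReal (p : ℂ[X]) (x : ℝ) :
    (p.map (starRingEnd ℂ)).eval (x : ℂ) = starRingEnd ℂ (p.eval (x : ℂ)) := by
  rw [Polynomial.eval_map, ← Polynomial.eval₂_hom, Complex.conj_ofReal]

theorem ofReal_norm_sq_eval (p : ℂ[X]) (x : ℝ) :
    ((‖p.eval (x : ℂ)‖ ^ 2 : ℝ) : ℂ) = (p.map (starRingEnd ℂ) * p).eval (x : ℂ) := by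
  rw [Polynomial.eval_mul, eval_map_conj_ofReal, Complex.conj_mul', Complex.ofReal_pow]

theorem IsSolution.integrable_norm_sq_eval {s : ℕ → ℝ} {μ : Measure ℝ} (h : IsSolution s μ)
    (p : ℂ[X]) : Integrable (fun x : ℝ => ‖p.eval (x : ℂ)‖ ^ 2) μ := by
  have := (h.integrable_eval (p.map (starRingEnd ℂ) * p)).re
  simpa only [← ofReal_norm_sq_eval, RCLike.re_to_complex, Complex.ofReal_re] using this

theorem IsSolution.ofReal_integral_norm_sq_eval {s : ℕ → ℝ} {μ : Measure ℝ} (h : IsSolution s μ)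
    (p : ℂ[X]) : ((∫ x : ℝ, ‖p.eval (x : ℂ)‖ ^ 2 ∂μ : ℝ) : ℂ) =
      (p.map (starRingEnd ℂ) * p).sum fun n a => a * s n := by
  rw [← h.integral_eval, ← integral_complex_ofReal]
  simp only [ofReal_norm_sq_eval]

theorem IsSolution.integral_norm_eval_le {s : ℕ → ℝ} {μ : Measure ℝ} (h : IsSolution s μ)
    {p : ℂ[X]} {δ : ℝ} (hδ : 0 < δ) (hp : ∫ x : ℝ, ‖p.eval (x : ℂ)‖ ^ 2 ∂μ ≤ δ ^ 2) :
    ∫ x : ℝ, ‖p.eval (x : ℂ)‖ ∂μ ≤ δ := by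
  have := h.isProbabilityMeasure
  have h2 := h.integrable_norm_sq_eval p
  calc ∫ x : ℝ, ‖p.eval (x : ℂ)‖ ∂μ
      ≤ ∫ x : ℝ, (‖p.eval (x : ℂ)‖ ^ 2 * (2 * δ)⁻¹ + δ / 2) ∂μ := by
        refine integral_mono (h.integrable_eval p).norm
          ((h2.mul_const _).add (integrable_const _)) fun x => ?_
        have e : ‖p.eval (x : ℂ)‖ ^ 2 * (2 * δ)⁻¹ + δ / 2 - ‖p.eval (x : ℂ)‖
            = (‖p.eval (x : ℂ)‖ - δ) ^ 2 * (2 * δ)⁻¹ := by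
          field_simp
          ring
        have : 0 ≤ (‖p.eval (x : ℂ)‖ - δ) ^ 2 * (2 * δ)⁻¹ := by positivity
        simp only
        linarith
    _ = (∫ x : ℝ, ‖p.eval (x : ℂ)‖ ^ 2 ∂μ) * (2 * δ)⁻¹ + δ / 2 := by
        rw [integral_add (h2.mul_const _) (integrable_const _), integral_mul_const]
        simp
    _ ≤ δ ^ 2 * (2 * δ)⁻¹ + δ / 2 := by gcongr
    _ = δ := by
        field_simp
        ring

theorem exists_eq_C_add_mul (p : ℂ[X]) (z : ℂ) : ∃ r : ℂ[X], p = C (p.eval z) + (X - C z) * r := by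
  obtain ⟨r, hr⟩ := X_sub_C_dvd_sub_C_eval (a := z) (p := p)
  exact ⟨r, by rw [← hr]; ring⟩

/-! ### Determinacy when evaluation at `i` is unbounded -/

/-- The bounded function `x ↦ 1 / (x - i)` on the real line. -/
noncomputable def resolventFun : BoundedContinuousFunction ℝ ℂ :=
  BoundedContinuousFunction.ofNormedAddCommGroup (fun x : ℝ => ((x : ℂ) - Complex.I)⁻¹)
    (Continuous.inv₀ (by fun_prop) fun x h => by simpa using congrArg Complex.im h) 1
    (fun x => by
      rw [norm_inv]
      refine inv_le_one_of_one_le₀ ?_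
      simpa using Complex.abs_im_le_norm ((x : ℂ) - Complex.I))

theorem resolventFun_apply (x : ℝ) : resolventFun x = ((x : ℂ) - Complex.I)⁻¹ := rfl

theorem ofReal_sub_I_ne_zero (x : ℝ) : (x : ℂ) - Complex.I ≠ 0 :=
  fun h => by simpa using congrArg Complex.im h

/-- `g` does not distinguish `μ` from `ν` when integrated against polynomials. -/
def AgreeOnPolys (μ ν : Measure ℝ) (g : BoundedContinuousFunction ℝ ℂ) : Prop :=
  ∀ p : ℂ[X], ∫ x : ℝ, g x * p.eval (x : ℂ) ∂μ = ∫ x : ℝ, g x * p.eval (x : ℂ) ∂ν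

theorem IsSolution.integrable_bcf_mul_eval {s : ℕ → ℝ} {μ : Measure ℝ} (h : IsSolution s μ)
    (g : BoundedContinuousFunction ℝ ℂ) (p : ℂ[X]) :
    Integrable (fun x : ℝ => g x * p.eval (x : ℂ)) μ :=
  (h.integrable_eval p).bdd_mul g.continuous.aestronglyMeasurable
    (Eventually.of_forall g.norm_coe_le_norm)

theorem AgreeOnPolys.star {μ ν : Measure ℝ} {g : BoundedContinuousFunction ℝ ℂ}
    (hg : AgreeOnPolys μ ν g) : AgreeOnPolys μ ν (star g) := by
  intro p
  have e : ∀ x : ℝ, (Star.star g) x * p.eval (x : ℂ) =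
      starRingEnd ℂ (g x * (p.map (starRingEnd ℂ)).eval (x : ℂ)) := by
    intro x
    rw [map_mul, eval_map_conj_ofReal, Complex.conj_conj]
    rfl
  simp only [e]
  rw [integral_conj, integral_conj, hg]

/-- If evaluation at `i` is unbounded, then `1 / (x - i)` is a limit in `L²(μ)` and `L²(ν)` of the
same polynomials `(1 - q(x)) / (x - i)`, where `q(i) = 1` and `q` is small. -/
theorem AgreeOnPolys.mul_resolventFun {s : ℕ → ℝ} {μ ν : Measure ℝ} (hμ : IsSolution s μ)
    (hν : IsSolution s ν)
    (h : ∀ δ : ℝ, 0 < δ → ∃ p : ℂ[X], p.eval Complex.I = 1 ∧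
      ∫ x : ℝ, ‖p.eval (x : ℂ)‖ ^ 2 ∂μ ≤ δ ^ 2)
    {g : BoundedContinuousFunction ℝ ℂ} (hg : AgreeOnPolys μ ν g) :
    AgreeOnPolys μ ν (g * resolventFun) := by
  -- If `p = p(i) + (x - i) r`, then `g p / (x - i) = p(i) g / (x - i) + g r`.
  have split : ∀ (p r : ℂ[X]) (c : ℂ), p = C c + (X - C Complex.I) * r → ∀ x : ℝ,
      (g * resolventFun) x * p.eval (x : ℂ) = c * (g * resolventFun) x + g x * r.eval (x : ℂ) := by
    intro p r c hp x
    have := ofReal_sub_I_ne_zero x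
    simp only [hp, BoundedContinuousFunction.coe_mul, Pi.mul_apply, resolventFun_apply, eval_add,
      eval_C, eval_mul, eval_sub, eval_X]
    field_simp
  have int1 : ∀ {κ : Measure ℝ}, IsSolution s κ → Integrable (g * resolventFun) κ := by
    intro κ hκ
    have := hκ.integrable_bcf_mul_eval (g * resolventFun) 1
    simp only [eval_one, mul_one] at this
    exact this
  have intsplit : ∀ (p r : ℂ[X]) (c : ℂ), p = C c + (X - C Complex.I) * r →
      ∀ {κ : Measure ℝ}, IsSolution s κ → ∫ x : ℝ, (g * resolventFun) x * p.eval (x : ℂ) ∂κ =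
        c * ∫ x, (g * resolventFun) x ∂κ + ∫ x : ℝ, g x * r.eval (x : ℂ) ∂κ := by
    intro p r c hp κ hκ
    simp only [split p r c hp]
    rw [integral_add ((int1 hκ).const_mul c) (hκ.integrable_bcf_mul_eval g r), integral_const_mul]
  have key : ∫ x, (g * resolventFun) x ∂μ = ∫ x, (g * resolventFun) x ∂ν := by
    rw [← sub_eq_zero, ← norm_le_zero_iff]
    refine le_of_forall_pos_le_add fun ε hε => ?_
    set M : ℝ := ‖g * resolventFun‖ with hM
    have hM0 : 0 ≤ M := norm_nonneg _
    set δ : ℝ := ε / (2 * (M + 1)) with hδ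
    have hδ0 : 0 < δ := by positivity
    obtain ⟨q, hq1, hqμ⟩ := h δ hδ0
    have hqν : ∫ x : ℝ, ‖q.eval (x : ℂ)‖ ^ 2 ∂ν ≤ δ ^ 2 := by
      have : ∫ x : ℝ, ‖q.eval (x : ℂ)‖ ^ 2 ∂ν = ∫ x : ℝ, ‖q.eval (x : ℂ)‖ ^ 2 ∂μ := by
        rw [← Complex.ofReal_inj, hμ.ofReal_integral_norm_sq_eval, hν.ofReal_integral_norm_sq_eval]
      rwa [this]
    obtain ⟨r, hr⟩ := exists_eq_C_add_mul q Complex.I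
    rw [hq1] at hr
    have bound : ∀ {κ : Measure ℝ}, IsSolution s κ →
        ∫ x : ℝ, ‖q.eval (x : ℂ)‖ ^ 2 ∂κ ≤ δ ^ 2 →
        ‖∫ x : ℝ, (g * resolventFun) x * q.eval (x : ℂ) ∂κ‖ ≤ M * δ := by
      intro κ hκ hqκ
      calc ‖∫ x : ℝ, (g * resolventFun) x * q.eval (x : ℂ) ∂κ‖
          ≤ ∫ x : ℝ, M * ‖q.eval (x : ℂ)‖ ∂κ := by
            refine norm_integral_le_of_norm_le ((hκ.integrable_eval q).norm.const_mul M)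
              (Eventually.of_forall fun x => ?_)
            rw [norm_mul]
            gcongr
            exact BoundedContinuousFunction.norm_coe_le_norm _ x
        _ = M * ∫ x : ℝ, ‖q.eval (x : ℂ)‖ ∂κ := integral_const_mul _ _
        _ ≤ M * δ := by gcongr; exact hκ.integral_norm_eval_le hδ0 hqκ
    -- As `q = 1 + (x - i) r`, the function `g / (x - i)` differs from `g q / (x - i)` by `-g r`,
    -- which integrates to the same value against `μ` and `ν`.
    have e : (∫ x, (g * resolventFun) x ∂μ) - ∫ x, (g * resolventFun) x ∂ν =
        (∫ x : ℝ, (g * resolventFun) x * q.eval (x : ℂ) ∂μ) -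
          ∫ x : ℝ, (g * resolventFun) x * q.eval (x : ℂ) ∂ν := by
      rw [intsplit q r 1 hr hμ, intsplit q r 1 hr hν, hg r]
      ring
    rw [e]
    have hfin : M * δ + M * δ ≤ 0 + ε := by
      rw [hδ]
      have : M / (M + 1) ≤ 1 := by rw [div_le_one (by positivity)]; linarith
      calc M * (ε / (2 * (M + 1))) + M * (ε / (2 * (M + 1))) = ε * (M / (M + 1)) := by
            field_simp
            ring
        _ ≤ 0 + ε := by nlinarith
    exact (norm_sub_le _ _).trans ((add_le_add (bound hμ hqμ) (bound hν hqν)).trans hfin)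
  intro p
  obtain ⟨r, hr⟩ := exists_eq_C_add_mul p Complex.I
  rw [intsplit p r _ hr hμ, intsplit p r _ hr hν, key, hg r]

/-- The bounded functions that preserve `AgreeOnPolys μ ν` under multiplication. Unlike the
functions satisfying `AgreeOnPolys μ ν` themselves, they form a star subalgebra. -/
noncomputable def agreeMultipliers {s : ℕ → ℝ} {μ ν : Measure ℝ} (hμ : IsSolution s μ)
    (hν : IsSolution s ν) : StarSubalgebra ℂ (BoundedContinuousFunction ℝ ℂ) where
  carrier := {f | ∀ g, AgreeOnPolys μ ν g → AgreeOnPolys μ ν (g * f)}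
  mul_mem' := by
    intro a b ha hb g hg
    rw [← mul_assoc]
    exact hb _ (ha _ hg)
  add_mem' := by
    intro a b ha hb g hg p
    simp only [mul_add, BoundedContinuousFunction.coe_add, Pi.add_apply, add_mul]
    rw [integral_add (hμ.integrable_bcf_mul_eval _ p) (hμ.integrable_bcf_mul_eval _ p),
      integral_add (hν.integrable_bcf_mul_eval _ p) (hν.integrable_bcf_mul_eval _ p),
      ha g hg p, hb g hg p]
  algebraMap_mem' := by
    intro c g hg p
    have e : ∀ x : ℝ, (g * algebraMap ℂ (BoundedContinuousFunction ℝ ℂ) c) x * p.eval (x : ℂ) =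
        c * (g x * p.eval (x : ℂ)) := by
      intro x
      simp
      ring
    simp only [e, integral_const_mul]
    rw [hg p]
  star_mem' := by
    intro a ha g hg
    have := (ha _ hg.star).star
    rwa [star_mul', star_star] at this

/-- If some polynomials with value `1` at `i` have arbitrarily small norm in `L²(μ)`, then the
moment problem solved by `μ` is determinate. -/
theorem IsSolution.eq_of_eval_unbounded {s : ℕ → ℝ} {μ ν : Measure ℝ} (hμ : IsSolution s μ)
    (hν : IsSolution s ν)
    (h : ∀ δ : ℝ, 0 < δ → ∃ p : ℂ[X], p.eval Complex.I = 1 ∧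
      ∫ x : ℝ, ‖p.eval (x : ℂ)‖ ^ 2 ∂μ ≤ δ ^ 2) : μ = ν := by
  have := hμ.isProbabilityMeasure
  have := hν.isProbabilityMeasure
  refine ext_of_forall_mem_subalgebra_integral_eq_of_polish (𝕜 := ℂ)
    (A := agreeMultipliers hμ hν) ?_ ?_
  · intro x y hxy
    refine ⟨resolventFun, ⟨_, ⟨resolventFun,
      fun g hg => hg.mul_resolventFun hμ hν h, rfl⟩, rfl⟩, ?_⟩
    intro e
    have : ((x : ℂ) - Complex.I)⁻¹ = ((y : ℂ) - Complex.I)⁻¹ := e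
    exact hxy (by simpa using this)
  · intro g hg
    have h1 : AgreeOnPolys μ ν 1 := fun p => by
      simp [hμ.integral_eval, hν.integral_eval]
    simpa using hg 1 h1 1

/-! ### Orthonormality of the Gram-Schmidt polynomials -/

/-- `momentFunctional` as a linear map. -/
noncomputable def momentLinear (s : ℕ → ℝ) : ℝ[X] →ₗ[ℝ] ℝ :=
  Polynomial.lsum fun n => LinearMap.toSpanSingleton ℝ ℝ (s n)

theorem momentFunctional_eq (s : ℕ → ℝ) (p : ℝ[X]) : momentFunctional s p = momentLinear s p := by
  simp [momentFunctional, momentLinear, Polynomial.lsum_apply]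

theorem momentFunctional_X_pow (s : ℕ → ℝ) (n : ℕ) : momentFunctional s (X ^ n) = s n := by
  rw [momentFunctional, ← Polynomial.monomial_one_right_eq_X_pow, Polynomial.sum_monomial_index]
  · simp
  · simp

theorem polyInner_comm (s : ℕ → ℝ) (p q : ℝ[X]) : polyInner s p q = polyInner s q p := by
  rw [polyInner, polyInner, mul_comm]

theorem polyInner_sub_left (s : ℕ → ℝ) (p q r : ℝ[X]) :
    polyInner s (p - q) r = polyInner s p r - polyInner s q r := by
  simp [polyInner, momentFunctional_eq, sub_mul]

theorem polyInner_sum_left (s : ℕ → ℝ) {ι : Type*} (t : Finset ι) (p : ι → ℝ[X]) (r : ℝ[X]) :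
    polyInner s (∑ i ∈ t, p i) r = ∑ i ∈ t, polyInner s (p i) r := by
  simp [polyInner, momentFunctional_eq, Finset.sum_mul]

theorem polyInner_C_mul_left (s : ℕ → ℝ) (a : ℝ) (p r : ℝ[X]) :
    polyInner s (C a * p) r = a * polyInner s p r := by
  rw [polyInner, polyInner, momentFunctional_eq, momentFunctional_eq, mul_assoc, ← smul_eq_C_mul,
    map_smul, smul_eq_mul]

theorem polyInner_C_mul_right (s : ℕ → ℝ) (a : ℝ) (p r : ℝ[X]) :
    polyInner s p (C a * r) = a * polyInner s p r := by
  rw [polyInner_comm, polyInner_C_mul_left, polyInner_comm]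

theorem eval_map_ofRealHom (p : ℝ[X]) (x : ℝ) :
    (p.map Complex.ofRealHom).eval (x : ℂ) = ((p.eval x : ℝ) : ℂ) := by
  rw [Polynomial.eval_map]
  exact Polynomial.eval₂_at_apply Complex.ofRealHom x

/-- The inner product is positive definite, since the solutions have infinite support. -/
theorem IsIndeterminate.polyInner_self_pos {s : ℕ → ℝ} (hs : IsIndeterminate s) {p : ℝ[X]}
    (hp : p ≠ 0) : 0 < polyInner s p p := by
  obtain ⟨μ, ν, hμ, hν, hne⟩ := hs
  by_contra hle
  have e : polyInner s p p = ∫ x : ℝ, ‖(p.map Complex.ofRealHom).eval (x : ℂ)‖ ^ 2 ∂μ := by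
    rw [polyInner, momentFunctional_eq_integral hμ]
    refine integral_congr_ae (Eventually.of_forall fun x => ?_)
    simp only [eval_map_ofRealHom, Complex.norm_real, Real.norm_eq_abs, sq_abs, eval_mul]
    ring
  have h0 : ∫ x : ℝ, ‖(p.map Complex.ofRealHom).eval (x : ℂ)‖ ^ 2 ∂μ = 0 :=
    le_antisymm (by rw [← e]; exact not_lt.mp hle) (integral_nonneg fun x => by positivity)
  rw [integral_eq_zero_iff_of_nonneg (fun x => by positivity) (hμ.integrable_norm_sq_eval _)] at h0
  have hpC : p.map Complex.ofRealHom ≠ 0 :=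
    (Polynomial.map_ne_zero_iff Complex.ofRealHom.injective).mpr hp
  -- Dividing out the zero at `i` leaves a polynomial that vanishes almost everywhere, but not
  -- at `i`; this contradicts indeterminacy.
  obtain ⟨q, hq, hqi⟩ := exists_eq_pow_rootMultiplicity_mul_and_not_dvd _ hpC Complex.I
  rw [dvd_iff_isRoot, IsRoot.def] at hqi
  refine hne (hμ.eq_of_eval_unbounded hν fun δ _ => ⟨C (q.eval Complex.I)⁻¹ * q, ?_, ?_⟩)
  · simp [hqi]
  · have : (fun x : ℝ => ‖(C (q.eval Complex.I)⁻¹ * q).eval (x : ℂ)‖ ^ 2) =ᵐ[μ] 0 := by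
      filter_upwards [h0] with x hx
      rw [hq] at hx
      simpa [ofReal_sub_I_ne_zero x, hqi] using hx
    rw [integral_congr_ae this]
    simpa using sq_nonneg δ

theorem monicOrthPoly_degree_and_monic (s : ℕ → ℝ) (n : ℕ) :
    (monicOrthPoly s n).degree = n ∧ (monicOrthPoly s n).Monic := by
  induction n using Nat.strong_induction_on with
  | _ n ih =>
    have h : (∑ i : Fin n, C (polyInner s (X ^ n) (monicOrthPoly s i) /
        polyInner s (monicOrthPoly s i) (monicOrthPoly s i)) * monicOrthPoly s i).degree
          < (n : WithBot ℕ) := by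
      rw [Polynomial.degree_lt_iff_coeff_zero]
      intro m hm
      rw [Polynomial.finsetSum_coeff]
      refine Finset.sum_eq_zero fun i _ => ?_
      rw [coeff_C_mul, coeff_eq_zero_of_degree_lt, mul_zero]
      rw [(ih i i.isLt).1]
      exact_mod_cast i.isLt.trans_le hm
    rw [monicOrthPoly]
    refine ⟨?_, monic_X_pow_sub h⟩
    rw [degree_sub_eq_left_of_degree_lt] <;> rw [degree_X_pow]
    exact h

theorem IsIndeterminate.polyInner_monicOrthPoly_self_pos {s : ℕ → ℝ} (hs : IsIndeterminate s)
    (n : ℕ) : 0 < polyInner s (monicOrthPoly s n) (monicOrthPoly s n) :=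
  hs.polyInner_self_pos (monicOrthPoly_degree_and_monic s n).2.ne_zero

theorem IsIndeterminate.polyInner_monicOrthPoly_of_lt {s : ℕ → ℝ} (hs : IsIndeterminate s)
    (n : ℕ) : ∀ j < n, polyInner s (monicOrthPoly s n) (monicOrthPoly s j) = 0 := by
  induction n using Nat.strong_induction_on with
  | _ n ih =>
    intro j hj
    rw [monicOrthPoly, polyInner_sub_left, polyInner_sum_left, Finset.sum_eq_single ⟨j, hj⟩]
    · rw [polyInner_C_mul_left, div_mul_cancel₀ _ (hs.polyInner_monicOrthPoly_self_pos j).ne',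
        sub_self]
    · intro i _ hij
      have hij' : (i : ℕ) ≠ j := fun h => hij (Fin.ext h)
      rw [polyInner_C_mul_left]
      rcases lt_or_gt_of_ne hij' with h | h
      · rw [polyInner_comm s (monicOrthPoly s i) (monicOrthPoly s j), ih j hj i h, mul_zero]
      · rw [ih i i.isLt j h, mul_zero]
    · simp

theorem IsIndeterminate.polyInner_orthPoly {s : ℕ → ℝ} (hs : IsIndeterminate s) (m n : ℕ) :
    polyInner s (orthPoly s m) (orthPoly s n) = if m = n then 1 else 0 := by
  rw [orthPoly, orthPoly, polyInner_C_mul_left, polyInner_C_mul_right]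
  split_ifs with h
  · subst h
    have := hs.polyInner_monicOrthPoly_self_pos m
    have h2 := Real.mul_self_sqrt this.le
    have h3 := Real.sqrt_pos.mpr this
    field_simp
    rw [sq, h2]
  · rcases lt_or_gt_of_ne h with h | h
    · rw [polyInner_comm s (monicOrthPoly s m) (monicOrthPoly s n),
        hs.polyInner_monicOrthPoly_of_lt n m h]
      simp
    · rw [hs.polyInner_monicOrthPoly_of_lt m n h]
      simp

theorem IsIndeterminate.degree_orthPoly {s : ℕ → ℝ} (hs : IsIndeterminate s) (n : ℕ) :
    (orthPoly s n).degree = n := by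
  rw [orthPoly, degree_C_mul, (monicOrthPoly_degree_and_monic s n).1]
  exact inv_ne_zero (Real.sqrt_pos.mpr (hs.polyInner_monicOrthPoly_self_pos n)).ne'

theorem exists_eq_sum_of_degree_lt {K : Type*} [Field K] {P : ℕ → K[X]}
    (hP : ∀ n, (P n).degree = n) (n : ℕ) :
    ∀ q : K[X], q.degree < n → ∃ c : ℕ → K, q = ∑ k ∈ Finset.range n, C (c k) * P k := by
  induction n with
  | zero =>
    intro q hq
    refine ⟨0, ?_⟩
    rw [Polynomial.degree_lt_iff_coeff_zero] at hq
    ext m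
    simpa using hq m (Nat.zero_le m)
  | succ n ih =>
    intro q hq
    have hne : (P n).coeff n ≠ 0 := coeff_ne_zero_of_eq_degree (hP n)
    rw [Polynomial.degree_lt_iff_coeff_zero] at hq
    obtain ⟨c, hc⟩ := ih (q - C (q.coeff n / (P n).coeff n) * P n) (by
      rw [Polynomial.degree_lt_iff_coeff_zero]
      intro m hm
      rw [coeff_sub, coeff_C_mul]
      rcases hm.eq_or_lt with rfl | h
      · rw [div_mul_cancel₀ _ hne, sub_self]
      · have : (P n).coeff m = 0 := coeff_eq_zero_of_degree_lt (by rw [hP]; exact_mod_cast h)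
        rw [hq m h, this, mul_zero, sub_zero])
    refine ⟨Function.update c n (q.coeff n / (P n).coeff n), ?_⟩
    rw [Finset.sum_range_succ, Function.update_self, ← sub_eq_iff_eq_add, hc]
    refine Finset.sum_congr rfl fun k hk => ?_
    rw [Function.update_of_ne (Finset.mem_range.mp hk).ne]

/-- The orthonormal polynomials with complex coefficients. -/
noncomputable def orthPolyC (s : ℕ → ℝ) (n : ℕ) : ℂ[X] := (orthPoly s n).map Complex.ofRealHom

theorem coeff_orthPolyC (s : ℕ → ℝ) (n k : ℕ) : (orthPolyC s n).coeff k = coeffMatrix s k n := by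
  simp [orthPolyC, coeffMatrix]

theorem IsIndeterminate.degree_orthPolyC {s : ℕ → ℝ} (hs : IsIndeterminate s) (n : ℕ) :
    (orthPolyC s n).degree = n := by
  rw [orthPolyC, degree_map, hs.degree_orthPoly]

theorem IsIndeterminate.integral_orthPolyC_mul {s : ℕ → ℝ} (hs : IsIndeterminate s)
    {μ : Measure ℝ} (hμ : IsSolution s μ) (m n : ℕ) :
    ∫ x : ℝ, (orthPolyC s m).eval (x : ℂ) * (orthPolyC s n).eval (x : ℂ) ∂μ =
      if m = n then 1 else 0 := by
  simp only [orthPolyC, eval_map_ofRealHom, ← Complex.ofReal_mul]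
  rw [integral_complex_ofReal]
  have := hs.polyInner_orthPoly m n
  rw [polyInner, momentFunctional_eq_integral hμ] at this
  simp only [eval_mul] at this
  rw [this]
  split_ifs <;> simp

theorem IsIndeterminate.integral_sum_mul_orthPolyC {s : ℕ → ℝ} (hs : IsIndeterminate s)
    {μ : Measure ℝ} (hμ : IsSolution s μ) (c : ℕ → ℂ) {N k : ℕ} (hk : k < N) :
    ∫ x : ℝ, (∑ n ∈ Finset.range N, C (c n) * orthPolyC s n).eval (x : ℂ) *
      (orthPolyC s k).eval (x : ℂ) ∂μ = c k := by
  simp only [eval_finsetSum, Finset.sum_mul, eval_mul, eval_C, mul_assoc]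
  rw [integral_finsetSum]
  · simp only [integral_const_mul, hs.integral_orthPolyC_mul hμ]
    simp [hk]
  · intro n _
    refine Integrable.const_mul ?_ _
    simpa using hμ.integrable_eval (orthPolyC s n * orthPolyC s k)

theorem map_conj_orthPolyC (s : ℕ → ℝ) (n : ℕ) :
    (orthPolyC s n).map (starRingEnd ℂ) = orthPolyC s n := by
  ext k
  simp [coeff_orthPolyC]

theorem IsIndeterminate.integral_norm_sq_sum_orthPolyC {s : ℕ → ℝ} (hs : IsIndeterminate s)
    {μ : Measure ℝ} (hμ : IsSolution s μ) (c : ℕ → ℂ) (N : ℕ) :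
    ∫ x : ℝ, ‖(∑ n ∈ Finset.range N, C (c n) * orthPolyC s n).eval (x : ℂ)‖ ^ 2 ∂μ =
      ∑ n ∈ Finset.range N, ‖c n‖ ^ 2 := by
  rw [← Complex.ofReal_inj, ← integral_complex_ofReal]
  set p := ∑ n ∈ Finset.range N, C (c n) * orthPolyC s n with hp
  have e : ∀ x : ℝ, ((‖p.eval (x : ℂ)‖ ^ 2 : ℝ) : ℂ) =
      ∑ n ∈ Finset.range N, starRingEnd ℂ (c n) *
        (p.eval (x : ℂ) * (orthPolyC s n).eval (x : ℂ)) := by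
    intro x
    rw [ofReal_norm_sq_eval, eval_mul]
    nth_rewrite 1 [hp]
    simp only [Polynomial.map_sum, Polynomial.map_mul, map_C, map_conj_orthPolyC, eval_finsetSum,
      eval_mul, eval_C, Finset.sum_mul]
    exact Finset.sum_congr rfl fun n _ => by ring
  simp only [e]
  rw [integral_finsetSum]
  · rw [Complex.ofReal_sum]
    refine Finset.sum_congr rfl fun n hn => ?_
    rw [integral_const_mul, hs.integral_sum_mul_orthPolyC hμ c (Finset.mem_range.mp hn),
      Complex.conj_mul', Complex.ofReal_pow]
  · intro n _
    refine Integrable.const_mul ?_ _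
    simpa using hμ.integrable_eval (p * orthPolyC s n)

/-! ### Square summability of the values at `i` and of the Fourier coefficients of the resolvent -/

/-- Evaluation at `i` is bounded on the polynomials in `L²(μ)`, in terms of its coordinates. -/
theorem IsIndeterminate.summable_norm_sq_eval_I {s : ℕ → ℝ} (hs : IsIndeterminate s) :
    Summable fun n => ‖(orthPolyC s n).eval Complex.I‖ ^ 2 := by
  obtain ⟨μ, ν, hμ, hν, hne⟩ := id hs
  have hb : ∃ δ : ℝ, 0 < δ ∧ ∀ p : ℂ[X], p.eval Complex.I = 1 →
      δ ^ 2 < ∫ x : ℝ, ‖p.eval (x : ℂ)‖ ^ 2 ∂μ := by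
    by_contra! h
    exact hne (hμ.eq_of_eval_unbounded hν h)
  obtain ⟨δ, hδ, hb⟩ := hb
  refine summable_of_sum_range_le (c := (δ ^ 2)⁻¹) (fun n => by positivity) fun N => ?_
  set S := ∑ n ∈ Finset.range N, ‖(orthPolyC s n).eval Complex.I‖ ^ 2 with hS
  have hS0 : 0 ≤ S := Finset.sum_nonneg fun n _ => by positivity
  rcases hS0.eq_or_lt with h0 | h0
  · rw [← h0]
    positivity
  -- The normalized kernel `K_N(x, -i) / K_N(i, -i)` has value `1` at `i` and squared norm `1 / S`.
  set c : ℕ → ℂ := fun n => (S : ℂ)⁻¹ * starRingEnd ℂ ((orthPolyC s n).eval Complex.I) with hc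
  have h1 := hb (∑ n ∈ Finset.range N, C (c n) * orthPolyC s n) (by
    simp only [eval_finsetSum, eval_mul, eval_C, hc, mul_assoc, ← Finset.mul_sum, Complex.conj_mul']
    rw [inv_mul_eq_one₀ (by exact_mod_cast h0.ne'), hS]
    push_cast
    rfl)
  rw [hs.integral_norm_sq_sum_orthPolyC hμ] at h1
  have h2 : ∑ n ∈ Finset.range N, ‖c n‖ ^ 2 = S⁻¹ := by
    simp only [hc, norm_mul, mul_pow, ← Finset.mul_sum, RCLike.norm_conj]
    rw [← hS, norm_inv, Complex.norm_real, Real.norm_of_nonneg h0.le]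
    field_simp
  rw [h2] at h1
  exact ((lt_inv_comm₀ (by positivity) h0).mp h1).le

/-- Bessel's inequality for `1 / (x - i)` in `L²(μ)`. -/
theorem IsIndeterminate.summable_norm_sq_integral_resolventFun {s : ℕ → ℝ} (hs : IsIndeterminate s)
    {μ : Measure ℝ} (hμ : IsSolution s μ) :
    Summable fun n => ‖∫ x : ℝ, (orthPolyC s n).eval (x : ℂ) * resolventFun x ∂μ‖ ^ 2 := by
  have := hμ.isProbabilityMeasure
  have hmem : ∀ n, MemLp (fun x : ℝ => (orthPolyC s n).eval (x : ℂ)) 2 μ := fun n =>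
    (memLp_two_iff_integrable_sq_norm (hμ.integrable_eval _).aestronglyMeasurable).mpr
      (hμ.integrable_norm_sq_eval _)
  have hF : MemLp (fun x : ℝ => resolventFun x) 2 μ :=
    MemLp.of_bound resolventFun.continuous.aestronglyMeasurable ‖resolventFun‖
      (Eventually.of_forall resolventFun.norm_coe_le_norm)
  have hinner : ∀ n {f : ℝ → ℂ} (hf : MemLp f 2 μ), inner ℂ ((hmem n).toLp _) (hf.toLp _) =
      ∫ x : ℝ, (orthPolyC s n).eval (x : ℂ) * f x ∂μ := by
    intro n f hf
    rw [L2.inner_def]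
    refine integral_congr_ae ?_
    filter_upwards [(hmem n).coeFn_toLp, hf.coeFn_toLp] with x h1 h2
    rw [h1, h2, RCLike.inner_apply, ← eval_map_conj_ofReal, map_conj_orthPolyC, mul_comm]
  have horth : Orthonormal ℂ fun n => (hmem n).toLp _ := by
    rw [orthonormal_iff_ite]
    intro m n
    rw [hinner, hs.integral_orthPolyC_mul hμ]
  simpa only [hinner] using horth.inner_products_summable (hF.toLp _)

/-! ### Difference quotients at `i` in the orthonormal basis -/

theorem exists_eq_C_add_mul_degree_lt {p : ℂ[X]} {n : ℕ} (hp : p.degree = n) (z : ℂ) :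
    ∃ r : ℂ[X], p = C (p.eval z) + (X - C z) * r ∧ r.degree < n := by
  obtain ⟨r, hr⟩ := exists_eq_C_add_mul p z
  refine ⟨r, hr, ?_⟩
  rcases eq_or_ne r 0 with rfl | h0
  · simp
  have h1 : ((X - C z) * r).degree ≤ (n : WithBot ℕ) := by
    have e : (X - C z) * r = p - C (p.eval z) := eq_sub_of_add_eq' hr.symm
    rw [e]
    refine (degree_sub_le _ _).trans (max_le hp.le (degree_C_le.trans ?_))
    exact_mod_cast Nat.zero_le n
  rw [degree_mul, degree_X_sub_C, degree_eq_natDegree h0] at h1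
  rw [degree_eq_natDegree h0]
  norm_cast at h1 ⊢
  omega

theorem IsIndeterminate.integral_mul_orthPolyC_of_degree_lt {s : ℕ → ℝ} (hs : IsIndeterminate s)
    {μ : Measure ℝ} (hμ : IsSolution s μ) {n : ℕ} {t : ℂ[X]} (ht : t.degree < n) :
    ∫ x : ℝ, t.eval (x : ℂ) * (orthPolyC s n).eval (x : ℂ) ∂μ = 0 := by
  obtain ⟨c, hc⟩ := exists_eq_sum_of_degree_lt (fun n => hs.degree_orthPolyC n) n t ht
  have e : t = ∑ k ∈ Finset.range (n + 1),
      C (Function.update c n 0 k) * orthPolyC s k := by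
    rw [Finset.sum_range_succ, Function.update_self, C_0, zero_mul, add_zero, hc]
    refine Finset.sum_congr rfl fun k hk => ?_
    rw [Function.update_of_ne (Finset.mem_range.mp hk).ne]
  rw [e, hs.integral_sum_mul_orthPolyC hμ _ (Nat.lt_succ_self n), Function.update_self]

/-- The coefficient of `P_k` in the expansion of the difference quotient
`(P_n(x) - P_n(i)) / (x - i)`, for `k < n`. -/
noncomputable def diffQuotCoeff (s : ℕ → ℝ) (μ : Measure ℝ) (n k : ℕ) : ℂ :=
  (orthPolyC s k).eval Complex.I * (∫ x : ℝ, (orthPolyC s n).eval (x : ℂ) * resolventFun x ∂μ) -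
    (orthPolyC s n).eval Complex.I * ∫ x : ℝ, (orthPolyC s k).eval (x : ℂ) * resolventFun x ∂μ

theorem IsSolution.integrable_eval_mul_resolventFun {s : ℕ → ℝ} {μ : Measure ℝ}
    (hμ : IsSolution s μ) (p : ℂ[X]) :
    Integrable (fun x : ℝ => p.eval (x : ℂ) * resolventFun x) μ := by
  simpa only [mul_comm] using hμ.integrable_bcf_mul_eval resolventFun p

theorem sub_I_mul_resolventFun (x : ℝ) : ((x : ℂ) - Complex.I) * resolventFun x = 1 :=
  mul_inv_cancel₀ (ofReal_sub_I_ne_zero x)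

/-- `P_n(x) = P_n(i) + (x - i) ∑_{k < n} a_{n,k} P_k(x)`. Comparing coefficients of powers of `x`
gives Volterra equations for the rows of `B`. -/
theorem IsIndeterminate.orthPolyC_eq_add_mul_sum {s : ℕ → ℝ} (hs : IsIndeterminate s)
    {μ : Measure ℝ} (hμ : IsSolution s μ) (n : ℕ) :
    orthPolyC s n = C ((orthPolyC s n).eval Complex.I) +
      (X - C Complex.I) * ∑ k ∈ Finset.range n, C (diffQuotCoeff s μ n k) * orthPolyC s k := by
  obtain ⟨r, hr, hrd⟩ := exists_eq_C_add_mul_degree_lt (hs.degree_orthPolyC n) Complex.I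
  obtain ⟨c, hc⟩ := exists_eq_sum_of_degree_lt (fun n => hs.degree_orthPolyC n) n r hrd
  have hck : ∀ k < n, c k = diffQuotCoeff s μ n k := by
    intro k hk
    obtain ⟨t, ht, htd⟩ := exists_eq_C_add_mul_degree_lt (hs.degree_orthPolyC k) Complex.I
    have htn : t.degree < n := htd.trans (by exact_mod_cast hk)
    rw [← hs.integral_sum_mul_orthPolyC hμ c hk, ← hc]
    -- `(P_n - P_n(i)) P_k / (x - i) = P_n P_k / (x - i) - P_n(i) P_k / (x - i)`, and
    -- `P_n P_k / (x - i) = P_k(i) P_n / (x - i) + P_n t` with `t` orthogonal to `P_n`.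
    have e : ∀ x : ℝ, r.eval (x : ℂ) * (orthPolyC s k).eval (x : ℂ) =
        ((orthPolyC s k).eval Complex.I * ((orthPolyC s n).eval (x : ℂ) * resolventFun x) -
          (orthPolyC s n).eval Complex.I * ((orthPolyC s k).eval (x : ℂ) * resolventFun x)) +
        t.eval (x : ℂ) * (orthPolyC s n).eval (x : ℂ) := by
      intro x
      have h1 : (orthPolyC s n).eval (x : ℂ) =
          (orthPolyC s n).eval Complex.I + ((x : ℂ) - Complex.I) * r.eval (x : ℂ) := by
        simpa using congrArg (Polynomial.eval (x : ℂ)) hr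
      have h2 : (orthPolyC s k).eval (x : ℂ) =
          (orthPolyC s k).eval Complex.I + ((x : ℂ) - Complex.I) * t.eval (x : ℂ) := by
        simpa using congrArg (Polynomial.eval (x : ℂ)) ht
      have h3 := sub_I_mul_resolventFun x
      linear_combination (-resolventFun x * (orthPolyC s k).eval (x : ℂ)) * h1 +
        (resolventFun x * (orthPolyC s n).eval (x : ℂ)) * h2 +
        ((orthPolyC s n).eval (x : ℂ) * t.eval (x : ℂ) -
          r.eval (x : ℂ) * (orthPolyC s k).eval (x : ℂ)) * h3
    simp only [e]
    rw [integral_add, integral_sub, integral_const_mul, integral_const_mul,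
      hs.integral_mul_orthPolyC_of_degree_lt hμ htn, add_zero, diffQuotCoeff]
    · exact (hμ.integrable_eval_mul_resolventFun _).const_mul _
    · exact (hμ.integrable_eval_mul_resolventFun _).const_mul _
    · exact ((hμ.integrable_eval_mul_resolventFun _).const_mul _).sub
        ((hμ.integrable_eval_mul_resolventFun _).const_mul _)
    · simpa using hμ.integrable_eval (t * orthPolyC s n)
  rw [Finset.sum_congr rfl fun k hk => by rw [← hck k (Finset.mem_range.mp hk)], ← hc]
  exact hr

theorem norm_sub_sq_le_two_mul (z w : ℂ) : ‖z - w‖ ^ 2 ≤ 2 * ‖z‖ ^ 2 + 2 * ‖w‖ ^ 2 := by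
  have h1 := norm_sub_le z w
  have h2 := norm_nonneg (z - w)
  nlinarith [sq_nonneg (‖z‖ - ‖w‖)]

/-- The strictly lower triangular matrix of the difference quotient operator is Hilbert-Schmidt. -/
theorem IsIndeterminate.summable_norm_sq_diffQuotCoeff {s : ℕ → ℝ} (hs : IsIndeterminate s)
    {μ : Measure ℝ} (hμ : IsSolution s μ) :
    Summable fun n => ∑ k ∈ Finset.range n, ‖diffQuotCoeff s μ n k‖ ^ 2 := by
  have he := hs.summable_norm_sq_eval_I
  have hq := hs.summable_norm_sq_integral_resolventFun hμ
  set e : ℕ → ℂ := fun n => (orthPolyC s n).eval Complex.I with he'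
  set q : ℕ → ℂ := fun n => ∫ x : ℝ, (orthPolyC s n).eval (x : ℂ) * resolventFun x ∂μ with hq'
  refine Summable.of_nonneg_of_le (fun n => Finset.sum_nonneg fun k _ => by positivity) (fun n => ?_)
    ((hq.mul_left (2 * ∑' k, ‖e k‖ ^ 2)).add (he.mul_left (2 * ∑' k, ‖q k‖ ^ 2)))
  have h1 := he.sum_le_tsum (Finset.range n) fun k _ => by positivity
  have h2 := hq.sum_le_tsum (Finset.range n) fun k _ => by positivity
  calc ∑ k ∈ Finset.range n, ‖diffQuotCoeff s μ n k‖ ^ 2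
      ≤ ∑ k ∈ Finset.range n, (2 * ‖q n‖ ^ 2 * ‖e k‖ ^ 2 + 2 * ‖e n‖ ^ 2 * ‖q k‖ ^ 2) := by
        refine Finset.sum_le_sum fun k _ => (norm_sub_sq_le_two_mul _ _).trans_eq ?_
        rw [norm_mul, norm_mul, mul_pow, mul_pow]
        ring
    _ = 2 * ‖q n‖ ^ 2 * ∑ k ∈ Finset.range n, ‖e k‖ ^ 2 +
          2 * ‖e n‖ ^ 2 * ∑ k ∈ Finset.range n, ‖q k‖ ^ 2 := by
        rw [Finset.sum_add_distrib, Finset.mul_sum, Finset.mul_sum]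
    _ ≤ 2 * ‖q n‖ ^ 2 * ∑' k, ‖e k‖ ^ 2 + 2 * ‖e n‖ ^ 2 * ∑' k, ‖q k‖ ^ 2 := by gcongr
    _ = _ := by ring

/-! ### Volterra equations with a Hilbert-Schmidt kernel -/

/-- Discrete Grönwall inequality with summable coefficients. -/
theorem summable_of_le_add_mul_sum {b c A : ℕ → ℝ} (hb : ∀ n, 0 ≤ b n) (hc0 : ∀ n, 0 ≤ c n)
    (hA0 : ∀ n, 0 ≤ A n) (hc : Summable c) (hA : Summable A)
    (h : ∀ n, b n ≤ c n + A n * ∑ k ∈ Finset.range n, b k) : Summable b := by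
  have key : ∀ n, ∑ k ∈ Finset.range n, b k ≤
      Real.exp (∑ k ∈ Finset.range n, A k) * ∑ k ∈ Finset.range n, c k := by
    intro n
    induction n with
    | zero => simp
    | succ n ih =>
      rw [Finset.sum_range_succ, Finset.sum_range_succ A, Finset.sum_range_succ c]
      have hS : 0 ≤ ∑ k ∈ Finset.range n, b k := Finset.sum_nonneg fun k _ => hb k
      have hAS : 0 ≤ ∑ k ∈ Finset.range n, A k := Finset.sum_nonneg fun k _ => hA0 k
      calc (∑ k ∈ Finset.range n, b k) + b n
          ≤ (A n + 1) * (∑ k ∈ Finset.range n, b k) + c n := by linarith [h n]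
        _ ≤ Real.exp (A n) * (Real.exp (∑ k ∈ Finset.range n, A k) *
              ∑ k ∈ Finset.range n, c k) + c n := by
            gcongr
            exact Real.add_one_le_exp _
        _ ≤ Real.exp (A n) * (Real.exp (∑ k ∈ Finset.range n, A k) *
              ∑ k ∈ Finset.range n, c k) + Real.exp ((∑ k ∈ Finset.range n, A k) + A n) * c n := by
            gcongr
            exact le_mul_of_one_le_left (hc0 n) (Real.one_le_exp (add_nonneg hAS (hA0 n)))
        _ = _ := by
            rw [Real.exp_add]
            ring
  refine summable_of_sum_range_le (c := Real.exp (∑' k, A k) * ∑' k, c k) hb fun n =>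
    (key n).trans ?_
  have h1 := hA.sum_le_tsum (Finset.range n) fun k _ => hA0 k
  have h2 := hc.sum_le_tsum (Finset.range n) fun k _ => hc0 k
  have h3 : 0 ≤ ∑ k ∈ Finset.range n, c k := Finset.sum_nonneg fun k _ => hc0 k
  exact mul_le_mul (Real.exp_le_exp.mpr h1) h2 h3 (Real.exp_nonneg _)

theorem norm_sq_sum_mul_le (n : ℕ) (a β : ℕ → ℂ) :
    ‖∑ k ∈ Finset.range n, a k * β k‖ ^ 2 ≤
      (∑ k ∈ Finset.range n, ‖a k‖ ^ 2) * ∑ k ∈ Finset.range n, ‖β k‖ ^ 2 := by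
  refine le_trans ?_ (Finset.sum_mul_sq_le_sq_mul_sq _ _ _)
  gcongr
  exact (norm_sum_le _ _).trans_eq (Finset.sum_congr rfl fun k _ => norm_mul _ _)

theorem summable_norm_sq_volterra {a : ℕ → ℕ → ℂ} {β : ℕ → ℂ}
    (ha : Summable fun n => ∑ k ∈ Finset.range n, ‖a n k‖ ^ 2) (hβ : Summable fun n => ‖β n‖ ^ 2) :
    Summable fun n => ‖∑ k ∈ Finset.range n, a n k * β k‖ ^ 2 := by
  refine Summable.of_nonneg_of_le (fun n => by positivity) (fun n => ?_)
    (ha.mul_right (∑' k, ‖β k‖ ^ 2))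
  refine (norm_sq_sum_mul_le n (a n) β).trans ?_
  gcongr
  exact hβ.sum_le_tsum _ fun k _ => by positivity

/-- Square summable right-hand sides of the Volterra equation `β + z T β = c` have square summable
solutions. -/
theorem summable_norm_sq_of_volterra_eq {a : ℕ → ℕ → ℂ} {β c : ℕ → ℂ} {z : ℂ}
    (ha : Summable fun n => ∑ k ∈ Finset.range n, ‖a n k‖ ^ 2) (hc : Summable fun n => ‖c n‖ ^ 2)
    (h : ∀ n, β n = c n - z * ∑ k ∈ Finset.range n, a n k * β k) :
    Summable fun n => ‖β n‖ ^ 2 := by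
  refine summable_of_le_add_mul_sum (c := fun n => 2 * ‖c n‖ ^ 2)
    (A := fun n => 2 * ‖z‖ ^ 2 * ∑ k ∈ Finset.range n, ‖a n k‖ ^ 2) (fun n => by positivity)
    (fun n => by positivity) (fun n => by positivity) (hc.mul_left _) (ha.mul_left _) fun n => ?_
  rw [h n]
  refine (norm_sub_sq_le_two_mul _ _).trans ?_
  rw [norm_mul, mul_pow, mul_assoc (2 * ‖z‖ ^ 2), mul_assoc 2 (‖z‖ ^ 2)]
  gcongr
  exact norm_sq_sum_mul_le n (a n) β

/-! ### The rows of the coefficient matrix -/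

/-- The rows of `B` are square summable: equivalently, taking a fixed coefficient is a bounded
functional on the polynomials in `L²(μ)`. -/
theorem IsIndeterminate.summable_coeffMatrix_sq {s : ℕ → ℝ} (hs : IsIndeterminate s) (j : ℕ) :
    Summable fun n => coeffMatrix s j n ^ 2 := by
  obtain ⟨μ, _, hμ, -, -⟩ := id hs
  have ha := hs.summable_norm_sq_diffQuotCoeff hμ
  suffices h : ∀ j, Summable fun n => ‖(orthPolyC s n).coeff j‖ ^ 2 by
    simpa [coeff_orthPolyC] using h j
  intro j
  induction j with
  | zero =>
    refine summable_norm_sq_of_volterra_eq (z := Complex.I) ha hs.summable_norm_sq_eval_I fun n => ?_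
    have := congrArg (fun p : ℂ[X] => p.coeff 0) (hs.orthPolyC_eq_add_mul_sum hμ n)
    simp only [sub_mul, coeff_add, coeff_C_zero, coeff_sub, coeff_X_mul_zero, coeff_C_mul,
      finsetSum_coeff] at this
    rw [this]
    ring
  | succ j ih =>
    refine summable_norm_sq_of_volterra_eq (z := Complex.I) ha (summable_norm_sq_volterra ha ih)
      fun n => ?_
    have := congrArg (fun p : ℂ[X] => p.coeff (j + 1)) (hs.orthPolyC_eq_add_mul_sum hμ n)
    simp only [sub_mul, coeff_add, coeff_C_succ, coeff_sub, coeff_X_mul, coeff_C_mul,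
      finsetSum_coeff] at this
    rw [this]
    ring

theorem IsIndeterminate.summable_abs_coeffMatrix_mul {s : ℕ → ℝ} (hs : IsIndeterminate s)
    (k l : ℕ) : Summable fun n => |coeffMatrix s k n * coeffMatrix s l n| := by
  refine Summable.of_nonneg_of_le (fun n => abs_nonneg _) (fun n => ?_)
    ((hs.summable_coeffMatrix_sq k).add (hs.summable_coeffMatrix_sq l))
  rw [abs_le]
  constructor <;>
    nlinarith [sq_nonneg (coeffMatrix s k n - coeffMatrix s l n),
      sq_nonneg (coeffMatrix s k n + coeffMatrix s l n), sq_nonneg (coeffMatrix s k n),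
      sq_nonneg (coeffMatrix s l n)]

/-- `A = B Bᵗ`. -/
theorem IsIndeterminate.hasSum_kernelMatrix {s : ℕ → ℝ} (hs : IsIndeterminate s) (k l : ℕ) :
    HasSum (fun n => coeffMatrix s k n * coeffMatrix s l n) (kernelMatrix s k l) := by
  have h := (hs.summable_abs_coeffMatrix_mul k l).of_abs.hasSum
  have h2 : Tendsto (fun N => truncKernelCoeff s N k l) atTop
      (𝓝 (∑' n, coeffMatrix s k n * coeffMatrix s l n)) := by
    simp only [truncKernelCoeff_eq]
    exact h.tendsto_sum_nat.comp (tendsto_add_atTop_nat 1)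
  have e : kernelMatrix s k l = ∑' n, coeffMatrix s k n * coeffMatrix s l n := h2.limUnder_eq
  rwa [e]

theorem kernelMatrix_comm (s : ℕ → ℝ) (k l : ℕ) : kernelMatrix s k l = kernelMatrix s l k := by
  simp only [kernelMatrix, Matrix.of_apply, truncKernelCoeff_eq, mul_comm]

theorem IsIndeterminate.sum_abs_coeffMatrix_mul_le {s : ℕ → ℝ} (hs : IsIndeterminate s)
    (k l N : ℕ) : ∑ n ∈ Finset.range N, |coeffMatrix s k n * coeffMatrix s l n| ≤
      kernelDiagSqrt s k * kernelDiagSqrt s l := by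
  have hle : ∀ k, ∑ n ∈ Finset.range N, |coeffMatrix s k n| ^ 2 ≤ kernelMatrix s k k := by
    intro k
    simp only [sq_abs]
    simp only [sq]
    exact sum_le_hasSum _ (fun n _ => mul_self_nonneg _) (hs.hasSum_kernelMatrix k k)
  simp only [abs_mul]
  refine (Real.sum_mul_le_sqrt_mul_sqrt _ _ _).trans ?_
  exact mul_le_mul (Real.sqrt_le_sqrt (hle k)) (Real.sqrt_le_sqrt (hle l)) (Real.sqrt_nonneg _)
    (Real.sqrt_nonneg _)

/-! ### Products with the Hankel matrix -/

theorem IsIndeterminate.coeffMatrix_eq_zero {s : ℕ → ℝ} (hs : IsIndeterminate s) {l n : ℕ}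
    (h : n < l) : coeffMatrix s l n = 0 := by
  exact coeff_eq_zero_of_degree_lt (p := orthPoly s n)
    (by rw [hs.degree_orthPoly]; exact_mod_cast h)

/-- The column `n` of `B` paired with the column `m` of `H` is the inner product `⟨P_n, x ^ m⟩`. -/
theorem IsIndeterminate.hasSum_coeffMatrix_mul {s : ℕ → ℝ} (hs : IsIndeterminate s) (n m : ℕ) :
    HasSum (fun l => coeffMatrix s l n * s (l + m)) (polyInner s (X ^ m) (orthPoly s n)) := by
  have e : polyInner s (X ^ m) (orthPoly s n) =
      ∑ l ∈ Finset.range (n + 1), coeffMatrix s l n * s (l + m) := by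
    have hd : (orthPoly s n).natDegree < n + 1 := by
      rw [natDegree_eq_of_degree_eq_some (hs.degree_orthPoly n)]
      exact Nat.lt_succ_self n
    rw [polyInner_comm]
    nth_rewrite 1 [(orthPoly s n).as_sum_range_C_mul_X_pow' hd]
    rw [polyInner_sum_left]
    refine Finset.sum_congr rfl fun l _ => ?_
    rw [polyInner_C_mul_left, polyInner, ← pow_add, momentFunctional_X_pow]
    rfl
  rw [e]
  refine hasSum_sum_of_ne_finset_zero fun l hl => ?_
  rw [hs.coeffMatrix_eq_zero (by simpa using hl), zero_mul]

/-- Expansion of `x ^ m` in the orthonormal polynomials, read off at the coefficient of `x ^ k`. -/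
theorem IsIndeterminate.hasSum_coeffMatrix_mul_polyInner {s : ℕ → ℝ} (hs : IsIndeterminate s)
    (k m : ℕ) : HasSum (fun n => coeffMatrix s k n * polyInner s (X ^ m) (orthPoly s n))
      ((1 : Matrix ℕ ℕ ℝ) k m) := by
  obtain ⟨c, hc⟩ := exists_eq_sum_of_degree_lt hs.degree_orthPoly (m + 1) (X ^ m) (by
    rw [degree_X_pow]
    exact_mod_cast Nat.lt_succ_self m)
  have hin : ∀ n, polyInner s (X ^ m) (orthPoly s n) = if n < m + 1 then c n else 0 := by
    intro n
    rw [hc, polyInner_sum_left]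
    simp only [polyInner_C_mul_left, hs.polyInner_orthPoly]
    simp
  have e : (1 : Matrix ℕ ℕ ℝ) k m =
      ∑ n ∈ Finset.range (m + 1), coeffMatrix s k n * polyInner s (X ^ m) (orthPoly s n) := by
    have h := congrArg (fun p : ℝ[X] => p.coeff k) hc
    simp only [coeff_X_pow, finsetSum_coeff, coeff_C_mul] at h
    rw [Matrix.one_apply, h]
    refine Finset.sum_congr rfl fun n hn => ?_
    rw [hin, if_pos (Finset.mem_range.mp hn), mul_comm]
    rfl
  rw [e]
  refine hasSum_sum_of_ne_finset_zero fun n hn => ?_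
  rw [hin, if_neg (by simpa using hn), mul_zero]

theorem IsIndeterminate.hasSum_kernelMatrix_mul_hankel {s : ℕ → ℝ} (hs : IsIndeterminate s)
    (h : DoubleSeriesCondition s) (k m : ℕ) :
    HasSum (fun l => kernelMatrix s k l * hankel s l m) ((1 : Matrix ℕ ℕ ℝ) k m) := by
  -- Sum the double series over the rows and over the columns.
  have hF := (h k m).of_abs.hasSum
  have h1 := hF.prod_fiberwise fun n => by
    simpa only [mul_assoc] using (hs.hasSum_coeffMatrix_mul n m).mul_left (coeffMatrix s k n)
  have h2 := ((Equiv.prodComm ℕ ℕ).hasSum_iff.mpr hF).prod_fiberwise fun l =>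
    (hs.hasSum_kernelMatrix k l).mul_right (s (l + m))
  rw [h1.unique (hs.hasSum_coeffMatrix_mul_polyInner k m)] at h2
  exact h2

theorem DoubleSeriesCondition.propACI {s : ℕ → ℝ} (h : DoubleSeriesCondition s)
    (hs : IsIndeterminate s) : PropACI s := by
  refine ⟨fun i j => (hs.hasSum_kernelMatrix_mul_hankel h i j).summable.abs,
    fun i j => (hs.hasSum_kernelMatrix_mul_hankel h i j).tendsto_sum_nat, fun i j => ?_⟩
  have e : ∀ k, hankel s i k * kernelMatrix s k j = kernelMatrix s j k * hankel s k i := by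
    intro k
    rw [kernelMatrix_comm s k j, mul_comm, hankel, Matrix.of_apply, Matrix.of_apply, add_comm]
  simp only [e]
  rw [show (1 : Matrix ℕ ℕ ℝ) i j = (1 : Matrix ℕ ℕ ℝ) j i by
    simp only [Matrix.one_apply, eq_comm]]
  exact (hs.hasSum_kernelMatrix_mul_hankel h j i).tendsto_sum_nat

theorem PropCSStar.doubleSeriesCondition {s : ℕ → ℝ} (h : PropCSStar s)
    (hs : IsIndeterminate s) : DoubleSeriesCondition s := by
  intro k m
  rw [← (Equiv.prodComm ℕ ℕ).summable_iff, summable_prod_of_nonneg fun p => by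
    simp only [Function.comp_apply]
    exact abs_nonneg _]
  have e : ∀ l n, |coeffMatrix s k n * coeffMatrix s l n * s (l + m)| =
      |coeffMatrix s k n * coeffMatrix s l n| * |s (l + m)| := fun l n => abs_mul _ _
  simp only [Function.comp_apply, Equiv.prodComm_apply, Prod.fst_swap, Prod.snd_swap, e,
    tsum_mul_right]
  refine ⟨fun l => (hs.summable_abs_coeffMatrix_mul k l).mul_right _, ?_⟩
  refine Summable.of_nonneg_of_le
    (fun l => mul_nonneg (tsum_nonneg fun n => abs_nonneg _) (abs_nonneg _)) (fun l => ?_)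
    ((h m).mul_left (kernelDiagSqrt s k))
  rw [← mul_assoc]
  gcongr
  exact Real.tsum_le_of_sum_range_le (fun n => abs_nonneg _)
    fun N => hs.sum_abs_coeffMatrix_mul_le k l N

theorem PropCSStar.propCS {s : ℕ → ℝ} (h : PropCSStar s) : PropCS s := by
  refine Summable.of_abs ?_
  have := (h 0).comp_injective (i := fun n : ℕ => 2 * n) fun a b hab => by simpa using hab
  refine this.congr fun n => ?_
  have h0 : 0 ≤ kernelDiagSqrt s (2 * n) := Real.sqrt_nonneg _
  rw [abs_mul, abs_of_nonneg h0]
  rfl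

theorem PropAC.propC {s : ℕ → ℝ} (h : PropAC s) : PropC s :=
  ⟨Matrix.of fun i j => ∑' k, kernelMatrix s i k * hankel s k j,
    fun i j => (h i j).of_abs.hasSum.tendsto_sum_nat⟩

end HamburgerMoment

theorem theorem1p2 (s : ℕ → ℝ) (hs : HamburgerMoment.IsIndeterminate s) :
    -- `A = B Bᵗ` with absolutely convergent series; in particular the limits defining `A` exist
    (∀ k l, HasSum
      (fun n => HamburgerMoment.coeffMatrix s k n * HamburgerMoment.coeffMatrix s l n)
      (HamburgerMoment.kernelMatrix s k l)) ∧
    (HamburgerMoment.PropCSStar s → HamburgerMoment.PropACI s) ∧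
    (HamburgerMoment.PropACI s → HamburgerMoment.PropAC s) ∧
    (HamburgerMoment.PropAC s → HamburgerMoment.PropC s) ∧
    (HamburgerMoment.PropCSStar s → HamburgerMoment.PropCS s) ∧
    (HamburgerMoment.DoubleSeriesCondition s → HamburgerMoment.PropACI s) ∧
    (HamburgerMoment.PropCSStar s → HamburgerMoment.DoubleSeriesCondition s) :=
  ⟨hs.hasSum_kernelMatrix, fun h => (h.doubleSeriesCondition hs).propACI hs, fun h => h.1,
    fun h => h.propC, fun h => h.propCS, fun h => h.propACI hs,
    fun h => h.doubleSeriesCondition hs⟩
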